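/- Let $G$ be a bipartite simple graph on the vertex set $\{1,\dots,n\}$ with real adjacency matrix $M(G)$. The graph state $|G\rangle\in(\mathbb{C}^2)^{\otimes n}$ is the unit vector, unique up to a phase, with $S_i|G\rangle=|G\rangle$ for all $i$, where $S_i$ is the tensor product having $\sigma_x$ in position $i$, $\sigma_z$ in the positions adjacent to $i$, and the identity elsewhere. The Schmidt measure $E_S(|\psi\rangle)$ is $\log_2 r$, where $r$ is the minimal number of terms in an expression of $|\psi\rangle$ as a linear combination of product vectors; an $n$-qubit state has maximal Schmidt measure if $E_S=\lfloor n/2\rfloor$. Two $n$-qubit states $|\psi\rangle,|\varphi\rangle$ are LC-equivalent if $U|\psi\rangle\langle\psi|U^\dagger=|\varphi\rangle\langle\varphi|$ for some $U=C_1\otimes\cdots\otimes C_n$, where each $C_j$ is a $2\times2$ unitary matrix that permutes the Pauli matrices $\sigma_x,\sigma_y,\sigma_z$ up to signs under conjugation. Suppose that $|G\rangle$ has maximal Schmidt measure, that $M(G)$ is invertible over $\mathbb{R}$, and that the matrix obtained from $M(G)^{-1}$ by changing the sign of its negative entries is the adjacency matrix of a simple graph $G^I$ on $\{1,\dots,n\}$.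 Then $|G^I\rangle$ has maximal Schmidt measure, and $|G\rangle$ and $|G^I\rangle$ are LC-equivalent. -/

import Mathlib

open scoped Matrix

/-! States and operators of `n` qubits, indexed by the computational basis `Fin n → Fin 2`. -/

/-- Vectors of `(ℂ²)^{⊗ n}`, given by their coordinates in the computational basis. -/
abbrev QubitVec (n : ℕ) : Type := (Fin n → Fin 2) → ℂ

/-- Operators on `(ℂ²)^{⊗ n}`, as `2ⁿ × 2ⁿ` matrices. -/
abbrev QubitOp (n : ℕ) : Type := Matrix (Fin n → Fin 2) (Fin n → Fin 2) ℂ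

/-- The Pauli matrices `σ_x`, `σ_y`, `σ_z`, indexed by `0`, `1`, `2`. -/
def pauli : Fin 3 → Matrix (Fin 2) (Fin 2) ℂ :=
  ![!![0, 1; 1, 0], !![0, -Complex.I; Complex.I, 0], !![1, 0; 0, -1]]

/-- The tensor product `C 0 ⊗ C 1 ⊗ ⋯ ⊗ C (n - 1)` of one-qubit operators. -/
def tensorOp {n : ℕ} (C : Fin n → Matrix (Fin 2) (Fin 2) ℂ) : QubitOp n :=
  fun x y => ∏ j, C j (x j) (y j)

/-- The tensor product `v 0 ⊗ v 1 ⊗ ⋯ ⊗ v (n - 1)` of one-qubit vectors. -/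
def tensorVec {n : ℕ} (v : Fin n → Fin 2 → ℂ) : QubitVec n :=
  fun x => ∏ j, v j (x j)

/-! Graph states. -/

/-- The blocks of the matrix `S(G)`: `σ_x` on the diagonal, `σ_z` for edges, `I` for non-edges. -/
def stabilizerBlock {n : ℕ} (G : SimpleGraph (Fin n)) [DecidableRel G.Adj] (i j : Fin n) :
    Matrix (Fin 2) (Fin 2) ℂ :=
  if i = j then pauli 0 else if G.Adj i j then pauli 2 else 1

/-- The operator `S(G)_i`, the tensor product of the `i`-th row of blocks of `S(G)`. -/
def stabilizerOp {n : ℕ} (G : SimpleGraph (Fin n)) [DecidableRel G.Adj] (i : Fin n) : QubitOp n :=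
  tensorOp (stabilizerBlock G i)

/-- `ψ` is (a unit vector representing) the graph state `|G⟩`: a common eigenvector of all the
`S(G)_i` with eigenvalue `1`. It is determined up to a phase. -/
structure IsGraphState {n : ℕ} (G : SimpleGraph (Fin n)) [DecidableRel G.Adj]
    (ψ : QubitVec n) : Prop where
  norm_eq_one : ∑ x, ‖ψ x‖ ^ 2 = 1
  stabilized : ∀ i, stabilizerOp G i *ᵥ ψ = ψ

/-- Every graph has a graph state. -/
theorem exists_isGraphState {n : ℕ} (G : SimpleGraph (Fin n)) [DecidableRel G.Adj] :
    ∃ ψ : QubitVec n, IsGraphState G ψ := by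
  let c : (Fin n → Fin 2) → Fin n → Fin n → ℂ := fun x a b =>
    if a < b ∧ G.Adj a b ∧ x a = 1 ∧ x b = 1 then -1 else 1
  let r : ℝ := Real.sqrt ((2 ^ n : ℝ)⁻¹)
  refine ⟨fun x => (r : ℂ) * ∏ a, ∏ b, c x a b, ?_, ?_⟩
  · have hc : ∀ x a b, ‖c x a b‖ = 1 := by
      intro x a b
      simp only [c]
      split_ifs <;> simp
    have h1 : ∀ x, ‖(r : ℂ) * ∏ a, ∏ b, c x a b‖ ^ 2 = (2 ^ n : ℝ)⁻¹ := by
      intro x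
      rw [norm_mul, norm_prod]
      simp only [norm_prod, hc, Finset.prod_const_one, mul_one]
      rw [Complex.norm_real, Real.norm_eq_abs, sq_abs, Real.sq_sqrt (by positivity)]
    simp only [h1]
    simp
  · intro i
    funext x
    let z : Fin 2 → ℂ := fun a => if a = 1 then -1 else 1
    let y : Fin n → Fin 2 := Function.update x i (1 - x i)
    have hflip : ∀ a b, c y a b = c x a b *
        ((if a = i then (if i < b ∧ G.Adj i b then z (x b) else 1) else 1) *
         (if b = i then (if a < i ∧ G.Adj i a then z (x a) else 1) else 1)) := by
      intro a b
      have hx : x i = 0 ∨ x i = 1 := by omega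
      by_cases ha : a = i
      · subst ha
        by_cases hb : b = a
        · subst hb; simp [c]
        · rcases hx with h | h <;> by_cases h1 : a < b <;> by_cases h2 : G.Adj a b <;>
            by_cases h3 : x b = 1 <;> simp [c, y, z, h, hb, h1, h2, h3]
      · by_cases hb : b = i
        · subst hb
          rcases hx with h | h <;> by_cases h1 : a < b <;> by_cases h2 : G.Adj b a <;>
            by_cases h3 : x a = 1 <;>
            simp [c, y, z, h, ha, h1, h2, h3, G.adj_comm a b]
        · simp [c, y, ha, hb]
    have hprod : ∏ a, ∏ b, c y a b =
        (∏ a, ∏ b, c x a b) * ∏ b, (if G.Adj i b then z (x b) else 1) := by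
      simp only [hflip, Finset.prod_mul_distrib]
      congr 1
      have e1 : (∏ a, ∏ b, (if a = i then (if i < b ∧ G.Adj i b then z (x b) else 1) else 1))
          = ∏ b, (if i < b ∧ G.Adj i b then z (x b) else 1) := by
        rw [Finset.prod_eq_single i]
        · simp
        · intro a _ ha; simp [ha]
        · simp
      have e2 : (∏ a, ∏ b, (if b = i then (if a < i ∧ G.Adj i a then z (x a) else 1) else 1))
          = ∏ a, (if a < i ∧ G.Adj i a then z (x a) else 1) := by
        simp
      rw [e1, e2, ← Finset.prod_mul_distrib]
      refine Finset.prod_congr rfl fun b _ => ?_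
      by_cases h : G.Adj i b
      · rcases lt_or_gt_of_ne h.ne with h' | h'
        · simp [h, h', h'.not_gt]
        · simp [h, h', h'.not_gt]
      · simp [h]
    have hy : ∀ w, w ≠ y → stabilizerOp G i x w = 0 := by
      intro w hw
      obtain ⟨j, hj⟩ := Function.ne_iff.mp hw
      suffices h0 : stabilizerBlock G i j (x j) (w j) = 0 from
        Finset.prod_eq_zero (f := fun j => stabilizerBlock G i j (x j) (w j)) (Finset.mem_univ j) h0
      have hb : ∀ a b : Fin 2, b ≠ 1 - a → pauli 0 a b = 0 := by
        intro a b; fin_cases a <;> fin_cases b <;> simp [pauli]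
      have hd : ∀ a b : Fin 2, b ≠ a → pauli 2 a b = 0 := by
        intro a b; fin_cases a <;> fin_cases b <;> simp [pauli]
      unfold stabilizerBlock
      by_cases h : i = j
      · subst h
        simp only [if_true]
        exact hb _ _ (by simpa [y] using hj)
      · have hj' : w j ≠ x j := by simpa [y, Ne.symm h] using hj
        simp only [h, if_false]
        split_ifs
        · exact hd _ _ hj'
        · exact Matrix.one_apply_ne hj'.symm
    have hval : stabilizerOp G i x y = ∏ b, (if G.Adj i b then z (x b) else 1) := by
      change ∏ j, stabilizerBlock G i j (x j) (y j) = _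
      refine Finset.prod_congr rfl fun j _ => ?_
      have hb : ∀ a : Fin 2, pauli 0 a (1 - a) = 1 := by
        intro a; fin_cases a <;> simp [pauli]
      have hd : ∀ a : Fin 2, pauli 2 a a = z a := by
        intro a; fin_cases a <;> simp [pauli, z]
      unfold stabilizerBlock
      by_cases h : i = j
      · subst h
        simp [y, hb]
      · by_cases h2 : G.Adj i j
        · simp [h, h2, y, Ne.symm h, hd]
        · have hyj : y j = x j := by simp [y, Ne.symm h]
          simp only [h, h2, if_false, hyj, Matrix.one_apply_eq]
    have hsq : (∏ b, (if G.Adj i b then z (x b) else 1)) *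
        (∏ b, (if G.Adj i b then z (x b) else 1)) = 1 := by
      rw [← Finset.prod_mul_distrib]
      refine Finset.prod_eq_one fun b _ => ?_
      simp only [z]
      split_ifs <;> simp
    rw [Matrix.mulVec, dotProduct, Finset.sum_eq_single y (fun w _ hw => by simp [hy w hw])
      (by simp), hval, hprod]
    linear_combination (r : ℂ) * (∏ a, ∏ b, c x a b) * hsq

/-! The Schmidt measure. -/

/-- `ψ` is a linear combination of `R` product vectors. -/
def HasProductDecomposition {n : ℕ} (ψ : QubitVec n) (R : ℕ) : Prop :=
  ∃ (α : Fin R → ℂ) (v : Fin R → Fin n → Fin 2 → ℂ), ψ = ∑ k, α k • tensorVec (v k)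

/-- A decomposition exists, so that the minimum below is over a nonempty set. -/
theorem exists_hasProductDecomposition {n : ℕ} (ψ : QubitVec n) :
    ∃ R, HasProductDecomposition ψ R := by
  let e := Fintype.equivFin (Fin n → Fin 2)
  refine ⟨_, fun k => ψ (e.symm k), fun k j a => if a = e.symm k j then 1 else 0, ?_⟩
  funext x
  rw [Finset.sum_apply, Finset.sum_eq_single (e x)]
  · simp [tensorVec]
  · intro k _ hk
    have hne : x ≠ e.symm k := fun h => hk (by simp [h])
    obtain ⟨j, hj⟩ := Function.ne_iff.mp hne
    have h0 : tensorVec (fun j a => if a = e.symm k j then (1 : ℂ) else 0) x = 0 :=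
      Finset.prod_eq_zero (Finset.mem_univ j) (by simp [hj])
    simp [h0]
  · simp

/-- The minimal number of terms in a decomposition of `ψ` into product vectors. -/
noncomputable def minProductTerms {n : ℕ} (ψ : QubitVec n) : ℕ :=
  sInf {R | HasProductDecomposition ψ R}

/-- The Schmidt measure `E_S(ψ) = log₂ r`, with `r` the minimal number of product terms. -/
noncomputable def schmidtMeasure {n : ℕ} (ψ : QubitVec n) : ℝ :=
  Real.logb 2 (minProductTerms ψ)

/-- Maximal Schmidt measure: `E_S` equals `⌊n / 2⌋`, the upper bound for two-colorable graph states
on `n` qubits. -/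
def HasMaximalSchmidtMeasure {n : ℕ} (ψ : QubitVec n) : Prop :=
  schmidtMeasure ψ = ((n / 2 : ℕ) : ℝ)

/-! Local Clifford equivalence. -/

/-- The one-qubit Clifford group: unitaries permuting the Pauli matrices up to sign. -/
def IsCliffordOne (C : Matrix (Fin 2) (Fin 2) ℂ) : Prop :=
  C ∈ Matrix.unitaryGroup (Fin 2) ℂ ∧
    ∃ π : Equiv.Perm (Fin 3), ∀ u, C * pauli u * Cᴴ = pauli (π u) ∨ C * pauli u * Cᴴ = -pauli (π u)

/-- The local Clifford group on `n` qubits: tensor products of one-qubit Clifford operators. -/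
def IsLocalClifford {n : ℕ} (U : QubitOp n) : Prop :=
  ∃ C : Fin n → Matrix (Fin 2) (Fin 2) ℂ, (∀ j, IsCliffordOne (C j)) ∧ U = tensorOp C

/-- LC-equivalence of pure states: `U |ψ⟩⟨ψ| U† = |φ⟩⟨φ|` for a local Clifford operator `U`. -/
def LCEquivalent {n : ℕ} (ψ φ : QubitVec n) : Prop :=
  ∃ U : QubitOp n, IsLocalClifford U ∧
    U * Matrix.vecMulVec ψ (star ψ) * Uᴴ = Matrix.vecMulVec φ (star φ)

/-! The graph of the inverse adjacency matrix. -/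

/-- `H` is the graph `G^I`: the real adjacency matrix of `G` is invertible, and that of `H` is
obtained from its inverse by changing the sign of the negative entries. -/
structure IsInverseGraph {n : ℕ} (G H : SimpleGraph (Fin n)) [DecidableRel G.Adj]
    [DecidableRel H.Adj] : Prop where
  nonsingular : IsUnit (G.adjMatrix ℝ).det
  adjMatrix_eq : H.adjMatrix ℝ = (G.adjMatrix ℝ)⁻¹.map (fun a => |a|)

/-!
The Hadamard transform `U = H ⊗ ⋯ ⊗ H` maps `|G⟩` to `|Gᴵ⟩` up to a phase, which gives both claims:
`U` is a local Clifford operator, and it is an involution that carries product vectors to product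
vectors, so that it preserves the minimal number of product terms.

In the computational basis, being stabilized by all `S(G)_i` means that flipping the bit `i` of `x`
multiplies `ψ x` by `∏ (-1) ^ (x b)`, the product being over the neighbors `b` of `i`
(`stabilizerOp_mulVec_eq_iff`). Such a `ψ` is determined by `ψ 0`, hence unique up to a scalar
(`IsStabilizedBy.mul_apply_zero`).

Let `T` be the set of neighbors of `k` in `Gᴵ`. The inverse of the adjacency matrix has entries in
`{-1, 0, 1}` and agrees with the adjacency matrix of `Gᴵ` modulo 2, so `T` has an odd number of
neighbors of `b` in `G` exactly when `b = k` (`IsInverseGraph.card_mod_two`). Since `G` is bipartite,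
the edges of `Gᴵ` also join the two color classes, so `T` is independent in `G`
(`IsInverseGraph.not_adj_of_adj`). Hence translating `x` by the indicator of `T` multiplies
`ψ x` by exactly `(-1) ^ (x k)`, without a further sign. Substituting `x + 1_T` for `x` in the sum
that defines `U ψ` then gives the flip rule of `Gᴵ` for `U ψ` (`IsStabilizedBy.hadamard`).
-/

/-! ### Signs and indicator vectors -/

/-- The sign `(-1) ^ a` of a bit `a`. -/
def bitSign (a : Fin 2) : ℂ := if a = 1 then -1 else 1

theorem bitSign_mul_self (a : Fin 2) : bitSign a * bitSign a = 1 := by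
  unfold bitSign; split_ifs <;> simp

theorem bitSign_pow (a : Fin 2) (m : ℕ) : bitSign a ^ m = if m % 2 = 1 then bitSign a else 1 := by
  conv_lhs => rw [← Nat.mod_add_div m 2, pow_add, pow_mul, sq, bitSign_mul_self, one_pow, mul_one]
  rcases Nat.mod_two_eq_zero_or_one m with h | h <;> simp [h]

/-- The bit string with ones exactly at the positions in `T`. -/
def indicatorBits {n : ℕ} (T : Finset (Fin n)) : Fin n → Fin 2 := fun j => if j ∈ T then 1 else 0

theorem indicatorBits_empty {n : ℕ} : indicatorBits (∅ : Finset (Fin n)) = 0 := by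
  funext j; simp [indicatorBits]

theorem indicatorBits_insert {n : ℕ} {T : Finset (Fin n)} {i : Fin n} (hi : i ∉ T) :
    indicatorBits (insert i T) = indicatorBits T + Pi.single i 1 := by
  funext j
  by_cases h : j = i
  · subst h; simp [indicatorBits, hi]
  · simp [indicatorBits, h]

theorem indicatorBits_filter_eq_one {n : ℕ} (x : Fin n → Fin 2) :
    indicatorBits {j | x j = 1} = x := by
  funext j
  have : x j = 0 ∨ x j = 1 := by omega
  rcases this with h | h <;> simp [indicatorBits, h]

/-! ### Graph states in the computational basis -/

/-- The rule that describes the graph state of `G` in the computational basis: flipping the bit `i`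
multiplies the amplitude by the product of the signs of the bits adjacent to `i`. -/
def IsStabilizedBy {n : ℕ} (G : SimpleGraph (Fin n)) [DecidableRel G.Adj] (ψ : QubitVec n) : Prop :=
  ∀ i x, ψ (x + Pi.single i 1) = (∏ b ∈ G.neighborFinset i, bitSign (x b)) * ψ x

theorem stabilizerOp_mulVec_apply {n : ℕ} (G : SimpleGraph (Fin n)) [DecidableRel G.Adj]
    (i : Fin n) (ψ : QubitVec n) (x : Fin n → Fin 2) :
    (stabilizerOp G i *ᵥ ψ) x =
      (∏ b ∈ G.neighborFinset i, bitSign (x b)) * ψ (x + Pi.single i 1) := by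
  have hoff : ∀ a b : Fin 2, b ≠ a + 1 → pauli 0 a b = 0 := by
    intro a b; fin_cases a <;> fin_cases b <;> simp [pauli]
  have hdiag : ∀ a b : Fin 2, b ≠ a → pauli 2 a b = 0 := by
    intro a b; fin_cases a <;> fin_cases b <;> simp [pauli]
  have hX : ∀ a : Fin 2, pauli 0 a (a + 1) = 1 := by
    intro a; fin_cases a <;> simp [pauli]
  have hZ : ∀ a : Fin 2, pauli 2 a a = bitSign a := by
    intro a; fin_cases a <;> simp [pauli, bitSign]
  rw [Matrix.mulVec, dotProduct, Finset.sum_eq_single (x + Pi.single i 1)]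
  · congr 1
    change ∏ j, stabilizerBlock G i j (x j) ((x + Pi.single i 1 : Fin n → Fin 2) j) = _
    rw [← Finset.prod_subset (Finset.subset_univ (G.neighborFinset i))]
    · refine Finset.prod_congr rfl fun b hb => ?_
      have hadj : G.Adj i b := by simpa using hb
      simp [stabilizerBlock, hadj, hadj.ne, hadj.ne', hZ]
    · intro b _ hb
      have hadj : ¬ G.Adj i b := by simpa using hb
      by_cases h : i = b
      · subst h; simp [stabilizerBlock, hX]
      · have hxb : (x + Pi.single i 1 : Fin n → Fin 2) b = x b := by simp [Ne.symm h]
        rw [hxb, stabilizerBlock, if_neg h, if_neg hadj, Matrix.one_apply_eq]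
  · intro w _ hw
    obtain ⟨j, hj⟩ := Function.ne_iff.mp hw
    refine mul_eq_zero_of_left (Finset.prod_eq_zero
      (f := fun j => stabilizerBlock G i j (x j) (w j)) (Finset.mem_univ j) ?_) _
    simp only [stabilizerBlock]
    by_cases h : i = j
    · subst h
      simp only [if_true]
      exact hoff _ _ (by simpa using hj)
    · have hj' : w j ≠ x j := by simpa [Ne.symm h] using hj
      simp only [h, if_false]
      split_ifs
      · exact hdiag _ _ hj'
      · exact Matrix.one_apply_ne hj'.symm
  · simp

theorem stabilizerOp_mulVec_eq_iff {n : ℕ} (G : SimpleGraph (Fin n)) [DecidableRel G.Adj]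
    (ψ : QubitVec n) : (∀ i, stabilizerOp G i *ᵥ ψ = ψ) ↔ IsStabilizedBy G ψ := by
  have hsq : ∀ (i : Fin n) (x : Fin n → Fin 2), (∏ b ∈ G.neighborFinset i, bitSign (x b)) *
      (∏ b ∈ G.neighborFinset i, bitSign (x b)) = 1 := fun i x => by
    rw [← Finset.prod_mul_distrib]
    exact Finset.prod_eq_one fun b _ => bitSign_mul_self _
  refine forall_congr' fun i => ?_
  rw [funext_iff]
  refine forall_congr' fun x => ?_
  rw [stabilizerOp_mulVec_apply]
  constructor <;> intro h
  · conv_rhs => rw [← h]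
    rw [← mul_assoc, hsq, one_mul]
  · rw [h, ← mul_assoc, hsq, one_mul]

namespace IsStabilizedBy

variable {n : ℕ} {G : SimpleGraph (Fin n)} [DecidableRel G.Adj] {ψ φ : QubitVec n}

theorem eq_zero (hψ : IsStabilizedBy G ψ) (h0 : ψ 0 = 0) : ψ = 0 := by
  have key : ∀ T : Finset (Fin n), ψ (indicatorBits T) = 0 := by
    intro T
    induction T using Finset.induction_on with
    | empty => rw [indicatorBits_empty, h0]
    | insert i T hi ih => rw [indicatorBits_insert hi, hψ, ih, mul_zero]
  funext x
  rw [← indicatorBits_filter_eq_one x, key, Pi.zero_apply]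

/-- Two vectors that obey the flip rule of the same graph are proportional. -/
theorem mul_apply_zero (hψ : IsStabilizedBy G ψ) (hφ : IsStabilizedBy G φ) (x : Fin n → Fin 2) :
    ψ 0 * φ x = φ 0 * ψ x := by
  have h : IsStabilizedBy G (fun x => ψ 0 * φ x - φ 0 * ψ x) := fun i x => by
    simp only [hψ i x, hφ i x]; ring
  exact sub_eq_zero.mp (congrFun (h.eq_zero (by ring)) x)

/-- Flipping all bits in an independent set: no edge inside the set contributes a sign. -/
theorem apply_add_indicatorBits (hψ : IsStabilizedBy G ψ) (T : Finset (Fin n))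
    (hT : ∀ i ∈ T, ∀ j ∈ T, ¬ G.Adj i j) (x : Fin n → Fin 2) :
    ψ (x + indicatorBits T) = (∏ i ∈ T, ∏ b ∈ G.neighborFinset i, bitSign (x b)) * ψ x := by
  induction T using Finset.induction_on with
  | empty => simp [indicatorBits_empty]
  | insert i T hi ih =>
    rw [indicatorBits_insert hi, ← add_assoc, hψ, ih fun a ha b hb =>
      hT a (Finset.mem_insert_of_mem ha) b (Finset.mem_insert_of_mem hb),
      Finset.prod_insert hi, mul_assoc]
    congr 1
    refine Finset.prod_congr rfl fun b hb => ?_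
    have hb' : b ∉ T := fun h => hT i (Finset.mem_insert_self i T) b
      (Finset.mem_insert_of_mem h) (by simpa using hb)
    simp [indicatorBits, hb']

end IsStabilizedBy

/-! ### Tensor products of operators -/

theorem tensorOp_mul {n : ℕ} (C D : Fin n → Matrix (Fin 2) (Fin 2) ℂ) :
    tensorOp C * tensorOp D = tensorOp fun j => C j * D j := by
  funext x y
  simp only [tensorOp, Matrix.mul_apply, Finset.prod_univ_sum, Fintype.piFinset_univ,
    Finset.prod_mul_distrib]

theorem tensorOp_one {n : ℕ} : tensorOp (fun _ : Fin n => 1) = 1 := by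
  funext x y
  by_cases h : x = y
  · subst h; simp [tensorOp]
  · obtain ⟨j, hj⟩ := Function.ne_iff.mp h
    rw [Matrix.one_apply_ne h]
    exact Finset.prod_eq_zero (Finset.mem_univ j) (Matrix.one_apply_ne hj)

theorem conjTranspose_tensorOp {n : ℕ} (C : Fin n → Matrix (Fin 2) (Fin 2) ℂ) :
    (tensorOp C)ᴴ = tensorOp fun j => (C j)ᴴ := by
  funext x y
  simp [tensorOp, Matrix.conjTranspose_apply]

theorem tensorOp_mulVec_tensorVec {n : ℕ} (C : Fin n → Matrix (Fin 2) (Fin 2) ℂ)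
    (v : Fin n → Fin 2 → ℂ) : tensorOp C *ᵥ tensorVec v = tensorVec fun j => C j *ᵥ v j := by
  funext x
  simp only [tensorOp, tensorVec, Matrix.mulVec, dotProduct, Finset.prod_univ_sum,
    Fintype.piFinset_univ, Finset.prod_mul_distrib]

theorem HasProductDecomposition.smul_tensorOp_mulVec {n : ℕ} {ψ : QubitVec n} {R : ℕ}
    (h : HasProductDecomposition ψ R) (c : ℂ) (C : Fin n → Matrix (Fin 2) (Fin 2) ℂ) :
    HasProductDecomposition (c • tensorOp C *ᵥ ψ) R := by
  obtain ⟨α, v, rfl⟩ := h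
  refine ⟨fun k => c * α k, fun k j => C j *ᵥ v k j, ?_⟩
  simp only [Matrix.mulVec_sum, Matrix.mulVec_smul, tensorOp_mulVec_tensorVec, Finset.smul_sum,
    smul_smul]

/-! ### The Hadamard transform -/

/-- The Hadamard matrix. -/
noncomputable def hadamardMatrix : Matrix (Fin 2) (Fin 2) ℂ :=
  ((Real.sqrt 2 : ℝ) : ℂ)⁻¹ • !![1, 1; 1, -1]

theorem hadamardMatrix_add_one_left (a b : Fin 2) :
    hadamardMatrix (a + 1) b = bitSign b * hadamardMatrix a b := by
  fin_cases a <;> fin_cases b <;> simp [hadamardMatrix, bitSign]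

theorem hadamardMatrix_add_one_right (a b : Fin 2) :
    hadamardMatrix a (b + 1) = bitSign a * hadamardMatrix a b := by
  fin_cases a <;> fin_cases b <;> simp [hadamardMatrix, bitSign]

theorem conjTranspose_hadamardMatrix : hadamardMatrixᴴ = hadamardMatrix := by
  ext a b
  fin_cases a <;> fin_cases b <;> simp [hadamardMatrix, Matrix.conjTranspose_apply]

theorem hadamardMatrix_conj (A : Matrix (Fin 2) (Fin 2) ℂ) :
    hadamardMatrix * A * hadamardMatrix =
      (2 : ℂ)⁻¹ • (!![1, 1; 1, -1] * A * !![1, 1; 1, -1]) := by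
  have h2 : ((Real.sqrt 2 : ℝ) : ℂ)⁻¹ * ((Real.sqrt 2 : ℝ) : ℂ)⁻¹ = 2⁻¹ := by
    rw [← mul_inv, ← Complex.ofReal_mul, Real.mul_self_sqrt (by norm_num)]
    norm_num
  simp only [hadamardMatrix, Matrix.smul_mul, Matrix.mul_smul, smul_smul, h2]

theorem hadamardMatrix_mul_self : hadamardMatrix * hadamardMatrix = 1 := by
  have h := hadamardMatrix_conj 1
  rw [mul_one] at h
  rw [h]
  ext a b
  fin_cases a <;> fin_cases b <;> norm_num [Matrix.mul_apply, Fin.sum_univ_two]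

theorem isCliffordOne_hadamardMatrix : IsCliffordOne hadamardMatrix := by
  refine ⟨?_, Equiv.swap 0 2, fun u => ?_⟩
  · rw [Matrix.mem_unitaryGroup_iff, Matrix.star_eq_conjTranspose, conjTranspose_hadamardMatrix,
      hadamardMatrix_mul_self]
  · have hZ : pauli 2 = !![1, 0; 0, -1] := rfl
    rw [conjTranspose_hadamardMatrix, hadamardMatrix_conj]
    fin_cases u
    · left
      change _ • (_ * pauli 0 * _) = pauli 2
      rw [hZ]
      ext a b
      fin_cases a <;> fin_cases b <;>
        norm_num [pauli, Matrix.mul_apply, Fin.sum_univ_two]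
    · right
      have h1 : Equiv.swap (0 : Fin 3) 2 1 = 1 := by decide
      ext a b
      fin_cases a <;> fin_cases b <;>
        norm_num [pauli, Matrix.mul_apply, Fin.sum_univ_two, h1] <;> ring
    · left
      change _ • (_ * pauli 2 * _) = pauli 0
      rw [hZ]
      ext a b
      fin_cases a <;> fin_cases b <;>
        norm_num [pauli, Matrix.mul_apply, Fin.sum_univ_two]

/-- The Hadamard transform on `n` qubits. -/
noncomputable def hadamardOp (n : ℕ) : QubitOp n := tensorOp fun _ => hadamardMatrix

theorem isLocalClifford_hadamardOp (n : ℕ) : IsLocalClifford (hadamardOp n) :=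
  ⟨_, fun _ => isCliffordOne_hadamardMatrix, rfl⟩

theorem hadamardOp_mul_self (n : ℕ) : hadamardOp n * hadamardOp n = 1 := by
  rw [hadamardOp, tensorOp_mul, hadamardMatrix_mul_self, tensorOp_one]

theorem conjTranspose_hadamardOp (n : ℕ) : (hadamardOp n)ᴴ = hadamardOp n := by
  rw [hadamardOp, conjTranspose_tensorOp, conjTranspose_hadamardMatrix]

theorem hadamardOp_mulVec_mulVec {n : ℕ} (ψ : QubitVec n) :
    hadamardOp n *ᵥ (hadamardOp n *ᵥ ψ) = ψ := by
  rw [Matrix.mulVec_mulVec, hadamardOp_mul_self, Matrix.one_mulVec]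

theorem sum_norm_sq_eq_dotProduct {n : ℕ} (ψ : QubitVec n) :
    ((∑ x, ‖ψ x‖ ^ 2 : ℝ) : ℂ) = star ψ ⬝ᵥ ψ := by
  simp [dotProduct, Complex.conj_mul']

theorem sum_norm_sq_hadamardOp_mulVec {n : ℕ} (ψ : QubitVec n) :
    ∑ x, ‖(hadamardOp n *ᵥ ψ) x‖ ^ 2 = ∑ x, ‖ψ x‖ ^ 2 := by
  apply Complex.ofReal_injective
  rw [sum_norm_sq_eq_dotProduct, sum_norm_sq_eq_dotProduct, Matrix.star_mulVec,
    ← Matrix.dotProduct_mulVec, conjTranspose_hadamardOp, hadamardOp_mulVec_mulVec]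

theorem hadamardOp_add_single_left {n : ℕ} (y x : Fin n → Fin 2) (k : Fin n) :
    hadamardOp n (y + Pi.single k 1) x = bitSign (x k) * hadamardOp n y x := by
  change ∏ j, hadamardMatrix ((y + Pi.single k 1 : Fin n → Fin 2) j) (x j) =
    bitSign (x k) * ∏ j, hadamardMatrix (y j) (x j)
  rw [← Finset.mul_prod_erase _ _ (Finset.mem_univ k),
    ← Finset.mul_prod_erase _ (fun j => hadamardMatrix (y j) (x j)) (Finset.mem_univ k),
    ← mul_assoc]
  congr 1
  · simp [hadamardMatrix_add_one_left]
  · refine Finset.prod_congr rfl fun j hj => ?_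
    simp [Finset.ne_of_mem_erase hj]

theorem hadamardOp_add_indicatorBits_right {n : ℕ} (y x : Fin n → Fin 2) (T : Finset (Fin n)) :
    hadamardOp n y (x + indicatorBits T) = (∏ j ∈ T, bitSign (y j)) * hadamardOp n y x := by
  change ∏ j, hadamardMatrix (y j) ((x + indicatorBits T) j) =
    (∏ j ∈ T, bitSign (y j)) * ∏ j, hadamardMatrix (y j) (x j)
  have h : ∏ j ∈ T, bitSign (y j) = ∏ j, if j ∈ T then bitSign (y j) else 1 := by simp
  rw [h, ← Finset.prod_mul_distrib]
  refine Finset.prod_congr rfl fun j _ => ?_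
  by_cases hj : j ∈ T <;> simp [indicatorBits, hj, hadamardMatrix_add_one_right]

/-! ### The inverse graph -/

namespace IsInverseGraph

variable {n : ℕ} {G H : SimpleGraph (Fin n)} [DecidableRel G.Adj] [DecidableRel H.Adj]

theorem abs_inv_apply (h : IsInverseGraph G H) (i j : Fin n) :
    |(G.adjMatrix ℝ)⁻¹ i j| = if H.Adj i j then 1 else 0 := by
  have := congrFun (congrFun h.adjMatrix_eq i) j
  rw [SimpleGraph.adjMatrix_apply, Matrix.map_apply] at this
  exact this.symm

/-- The adjacency matrices of `G` and its inverse graph are inverse to each other modulo 2. -/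
theorem card_mod_two (h : IsInverseGraph G H) (k b : Fin n) :
    (H.neighborFinset k ∩ G.neighborFinset b).card % 2 = if b = k then 1 else 0 := by
  -- An integer lift of the inverse, congruent modulo 2 to the adjacency matrix of `H`.
  have hlift : ∀ j, ∃ a : ℤ, (a : ℝ) = (G.adjMatrix ℝ)⁻¹ k j ∧
      (a : ZMod 2) = if H.Adj k j then 1 else 0 := by
    intro j
    have h1 := h.abs_inv_apply k j
    split_ifs at h1 ⊢ with hadj
    · rcases eq_or_eq_neg_of_abs_eq h1 with h2 | h2
      · exact ⟨1, by simp [h2], by simp⟩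
      · exact ⟨-1, by simp [h2], by decide⟩
    · exact ⟨0, by simp [abs_eq_zero.mp h1], by simp⟩
  choose a ha1 ha2 using hlift
  have hmul := congrFun (congrFun (Matrix.nonsing_inv_mul _ h.nonsingular) k) b
  simp only [Matrix.mul_apply, SimpleGraph.adjMatrix_apply, ← ha1, Matrix.one_apply] at hmul
  have hint : ∑ j, a j * (if G.Adj j b then 1 else 0) = if k = b then 1 else 0 := by
    exact_mod_cast hmul
  have hmod := congrArg (Int.cast : ℤ → ZMod 2) hint
  push_cast at hmod
  simp only [ha2] at hmod
  have hcard : (((H.neighborFinset k ∩ G.neighborFinset b).card : ℕ) : ZMod 2) =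
      if k = b then 1 else 0 := by
    rw [← hmod, Finset.card_eq_sum_ones, Nat.cast_sum, ← Finset.sum_subset (Finset.subset_univ
      (H.neighborFinset k ∩ G.neighborFinset b))]
    · refine Finset.sum_congr rfl fun j hj => ?_
      simp only [Finset.mem_inter, SimpleGraph.mem_neighborFinset] at hj
      simp [hj.1, hj.2.symm]
    · intro j _ hj
      simp only [Finset.mem_inter, SimpleGraph.mem_neighborFinset, not_and] at hj
      by_cases hk : H.Adj k j
      · simp [G.adj_comm j b, hj hk]
      · simp [hk]
  by_cases hkb : b = k
  · simp only [hkb, if_true] at hcard ⊢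
    have : ((_ : ℕ) : ZMod 2) = ((1 : ℕ) : ZMod 2) := hcard.trans Nat.cast_one.symm
    exact (ZMod.natCast_eq_natCast_iff' _ _ _).mp this
  · simp only [hkb, Ne.symm hkb, if_false] at hcard ⊢
    have : ((_ : ℕ) : ZMod 2) = ((0 : ℕ) : ZMod 2) := hcard.trans Nat.cast_zero.symm
    exact (ZMod.natCast_eq_natCast_iff' _ _ _).mp this

/-- A proper two-coloring of `G` is also proper for the inverse graph: conjugation by the diagonal
matrix of color signs negates the adjacency matrix of `G`, hence also its inverse. -/
theorem color_ne_of_adj (h : IsInverseGraph G H) (c : G.Coloring (Fin 2)) {i j : Fin n}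
    (hij : H.Adj i j) : c i ≠ c j := by
  let s : Fin n → ℝ := fun i => if c i = 1 then -1 else 1
  let D := Matrix.diagonal s
  have hDD : D * D = 1 := by
    rw [Matrix.diagonal_mul_diagonal, ← Matrix.diagonal_one]
    congr 1
    funext i
    simp only [s]
    split_ifs <;> simp
  have hconj : D * G.adjMatrix ℝ * D = -G.adjMatrix ℝ := by
    ext a b
    rw [Matrix.mul_diagonal, Matrix.diagonal_mul, Matrix.neg_apply, SimpleGraph.adjMatrix_apply]
    split_ifs with hab
    · have := c.valid hab
      have ha : c a = 0 ∨ c a = 1 := by omega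
      have hb : c b = 0 ∨ c b = 1 := by omega
      rcases ha with ha | ha <;> rcases hb with hb | hb <;> simp_all [s]
    · simp
  have hDinv : D⁻¹ = D := Matrix.inv_eq_right_inv hDD
  have hinv : D * (G.adjMatrix ℝ)⁻¹ * D = -(G.adjMatrix ℝ)⁻¹ := by
    have h1 : (D * G.adjMatrix ℝ * D)⁻¹ = D * (G.adjMatrix ℝ)⁻¹ * D := by
      rw [Matrix.mul_inv_rev, Matrix.mul_inv_rev, hDinv, mul_assoc]
    rw [← h1, hconj]
    refine Matrix.inv_eq_right_inv ?_
    rw [neg_mul_neg, Matrix.mul_nonsing_inv _ h.nonsingular]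
  intro hc
  have hentry := congrFun (congrFun hinv i) j
  rw [Matrix.mul_diagonal, Matrix.diagonal_mul, Matrix.neg_apply] at hentry
  have hss : s i * s j = 1 := by
    simp only [s, hc]
    split_ifs <;> simp
  have habs := h.abs_inv_apply i j
  rw [if_pos hij] at habs
  have h0 : (G.adjMatrix ℝ)⁻¹ i j = 0 := by
    linear_combination (1 / 2) * hentry - (1 / 2) * (G.adjMatrix ℝ)⁻¹ i j * hss
  simp [h0] at habs

/-- Two neighbors of `k` in the inverse graph have the same color, so `G` does not join them. -/
theorem not_adj_of_adj (h : IsInverseGraph G H) (hbip : G.IsBipartite) {k i j : Fin n}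
    (hi : H.Adj k i) (hj : H.Adj k j) : ¬ G.Adj i j := by
  obtain ⟨c⟩ := hbip
  intro hij
  have h1 := h.color_ne_of_adj c hi
  have h2 := h.color_ne_of_adj c hj
  have h3 := c.valid hij
  omega

/-- Collecting the signs over the neighbors `i` of `k` in the inverse graph, the sign of the bit `b`
occurs an odd number of times exactly for `b = k`. -/
theorem prod_bitSign (h : IsInverseGraph G H) (k : Fin n) (x : Fin n → Fin 2) :
    ∏ i ∈ H.neighborFinset k, ∏ b ∈ G.neighborFinset i, bitSign (x b) = bitSign (x k) := by
  have h1 : ∀ i, ∏ b ∈ G.neighborFinset i, bitSign (x b) =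
      ∏ b, if G.Adj b i then bitSign (x b) else 1 := by
    intro i
    rw [← Finset.prod_filter]
    refine Finset.prod_congr ?_ fun _ _ => rfl
    ext b
    simp [G.adj_comm]
  have h2 : ∀ b, (∏ i ∈ H.neighborFinset k, if G.Adj b i then bitSign (x b) else 1) =
      if b = k then bitSign (x b) else 1 := by
    intro b
    have hset : (H.neighborFinset k).filter (G.Adj b) =
        H.neighborFinset k ∩ G.neighborFinset b := by
      ext i; simp
    rw [← Finset.prod_filter, hset, Finset.prod_const, bitSign_pow, h.card_mod_two]
    by_cases hb : b = k <;> simp [hb]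
  simp only [h1]
  rw [Finset.prod_comm]
  simp [h2]

end IsInverseGraph

/-- The Hadamard transform turns the flip rule of `G` into that of the inverse graph. -/
theorem IsStabilizedBy.hadamard {n : ℕ} {G H : SimpleGraph (Fin n)} [DecidableRel G.Adj]
    [DecidableRel H.Adj] (hbip : G.IsBipartite) (hinv : IsInverseGraph G H) {ψ : QubitVec n}
    (hψ : IsStabilizedBy G ψ) : IsStabilizedBy H (hadamardOp n *ᵥ ψ) := by
  intro k y
  have hT : ∀ i ∈ H.neighborFinset k, ∀ j ∈ H.neighborFinset k, ¬ G.Adj i j := by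
    intro i hi j hj
    rw [SimpleGraph.mem_neighborFinset] at hi hj
    exact hinv.not_adj_of_adj hbip hi hj
  have hsq : (∏ j ∈ H.neighborFinset k, bitSign (y j)) *
      (∏ j ∈ H.neighborFinset k, bitSign (y j)) = 1 := by
    rw [← Finset.prod_mul_distrib]
    exact Finset.prod_eq_one fun _ _ => bitSign_mul_self _
  simp only [Matrix.mulVec, dotProduct]
  -- Substitute `x + 1_T` for `x` on the right, with `T` the set of neighbors of `k` in `H`.
  rw [← Equiv.sum_comp (Equiv.addRight (indicatorBits (H.neighborFinset k)))
    (fun x => hadamardOp n y x * ψ x), Finset.mul_sum]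
  refine Finset.sum_congr rfl fun x _ => ?_
  rw [Equiv.coe_addRight, hadamardOp_add_single_left, hadamardOp_add_indicatorBits_right,
    hψ.apply_add_indicatorBits _ hT, hinv.prod_bitSign]
  linear_combination (-bitSign (x k) * hadamardOp n y x * ψ x) * hsq

/-- The Hadamard transform maps the graph state of `G` to that of the inverse graph up to a phase. -/
theorem exists_phase_hadamardOp_mulVec {n : ℕ} {G H : SimpleGraph (Fin n)} [DecidableRel G.Adj]
    [DecidableRel H.Adj] (hbip : G.IsBipartite) (hinv : IsInverseGraph G H) {ψ φ : QubitVec n}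
    (hψ : IsGraphState G ψ) (hφ : IsGraphState H φ) :
    ∃ c : ℂ, ‖c‖ = 1 ∧ φ = c • hadamardOp n *ᵥ ψ := by
  set χ := hadamardOp n *ᵥ ψ with hχ
  have hsψ : IsStabilizedBy H χ :=
    ((stabilizerOp_mulVec_eq_iff G ψ).mp hψ.stabilized).hadamard hbip hinv
  have hsφ := (stabilizerOp_mulVec_eq_iff H φ).mp hφ.stabilized
  have hnorm : ∑ x, ‖χ x‖ ^ 2 = 1 := by
    rw [hχ, sum_norm_sq_hadamardOp_mulVec, hψ.norm_eq_one]
  have h0 : χ 0 ≠ 0 := by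
    intro h
    rw [hsψ.eq_zero h] at hnorm
    simp at hnorm
  have heq : φ = (φ 0 / χ 0) • χ := by
    funext x
    have := hsψ.mul_apply_zero hsφ x
    rw [Pi.smul_apply, smul_eq_mul, div_mul_eq_mul_div, eq_div_iff h0, ← this, mul_comm]
  refine ⟨φ 0 / χ 0, ?_, heq⟩
  have hn := hφ.norm_eq_one
  rw [heq] at hn
  simp only [Pi.smul_apply, smul_eq_mul, norm_mul, mul_pow, ← Finset.mul_sum, hnorm, mul_one] at hn
  exact (pow_eq_one_iff_of_nonneg (norm_nonneg _) two_ne_zero).mp hn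

theorem proposition7 {n : ℕ} (G GI : SimpleGraph (Fin n)) [DecidableRel G.Adj]
    [DecidableRel GI.Adj] (hbip : G.IsBipartite) (hinv : IsInverseGraph G GI)
    (ψ φ : QubitVec n) (hψ : IsGraphState G ψ) (hφ : IsGraphState GI φ)
    (hmax : HasMaximalSchmidtMeasure ψ) :
    HasMaximalSchmidtMeasure φ ∧ LCEquivalent ψ φ := by
  obtain ⟨c, hc, hcφ⟩ := exists_phase_hadamardOp_mulVec hbip hinv hψ hφ
  have hc0 : c ≠ 0 := fun h => by simp [h] at hc
  have hcψ : ψ = c⁻¹ • hadamardOp n *ᵥ φ := by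
    rw [hcφ, Matrix.mulVec_smul, hadamardOp_mulVec_mulVec, smul_smul, inv_mul_cancel₀ hc0, one_smul]
  constructor
  · have hterms : minProductTerms φ = minProductTerms ψ := by
      unfold minProductTerms
      congr 1
      ext R
      constructor <;> intro h
      · rw [Set.mem_ofPred_eq, hcψ]
        exact HasProductDecomposition.smul_tensorOp_mulVec h _ _
      · rw [Set.mem_ofPred_eq, hcφ]
        exact HasProductDecomposition.smul_tensorOp_mulVec h _ _
    rwa [HasMaximalSchmidtMeasure, schmidtMeasure, hterms]
  · refine ⟨hadamardOp n, isLocalClifford_hadamardOp n, ?_⟩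
    have hcc : c * star c = 1 := by
      rw [← starRingEnd_apply, Complex.mul_conj', hc]; simp
    rw [Matrix.mul_vecMulVec, Matrix.vecMulVec_mul, ← Matrix.star_mulVec, hcφ, star_smul,
      Matrix.smul_vecMulVec, Matrix.vecMulVec_smul, smul_smul, hcc, one_smul]
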